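/- Let $K$ be a field of positive characteristic $p>2$. Let $Div=Div[x_1|y_1,y_2]$ be the commutative divided power $K$-algebra with $K$-basis the monomials $x_1^{(i)}y^{(j_1,j_2)}:=x_1^{(i)}y_1^{(j_1)}y_2^{(j_2)}$, $i,j_1,j_2\ge 0$, and multiplication determined by $z^{(a)}z^{(b)}=\binom{a+b}{a}z^{(a+b)}$ for $z\in\{x_1,y_1,y_2\}$, graded by total degree, with derivations $\frac{d}{dx_1},\frac{d}{dy_j}$ satisfying $\frac{d}{dz}z^{(l)}=z^{(l-1)}$ ($l\geq 1$) and annihilating the divided powers of the other variables. A homogeneous element $f$ of degree $k$ is called supersymmetric if it is symmetric in $y_1,y_2$ and $\left(\frac{d}{dx_1}+\frac{d}{dy_1}\right)f=(x_1-y_1)f'$ for some $f'$ homogeneous of degree $k-2$; the sums of supersymmetric elements form a graded subalgebra $\mathcal S$ of $Div$. The leading term of a nonzero element is the largest monomial occurring in it with nonzero coefficient, for the lexicographic order with $x_1>y_1>y_2$. For $j_1\ge j_2\ge 0$ say that $(j_1,j_2)$ has height $1$ if either $0\le j_1<p-1$ and $j_2=0$, or $j_1\equiv p-1 \pmod p$;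 otherwise its height is $>1$. Theorem. Each of the monomials $M$ - $x_1^{(p^s)}$ for $s>0$, - $x_1y^{(j_1,j_2)}$ for $j_1\ge j_2\ge0$ with $(j_1,j_2)$ of height $1$, - $x_1^{(2)}y^{(j_1,j_2)}$ for $j_1\ge j_2\ge 0$ with $(j_1,j_2)$ of height $>1$ is the leading term of some supersymmetric element. Moreover, for every choice, for each monomial $M$ in this list, of a supersymmetric element $S(M)$ with leading term $M$, the elements $S(M)$ generate the $K$-algebra $\mathcal S$. -/

import Mathlib

noncomputable section

/-- The divided power algebra over `K` in commuting variables `z i`, `i : ι`.  As a `K`-module it is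
free on the divided power monomials `z^(a) = ∏ i, (z i)^(a i)`, indexed by exponents `a : ι → ℕ`;
an element is its finitely supported family of coefficients. -/
def DivAlg (K ι : Type*) [CommRing K] : Type _ := (ι → ℕ) →₀ K

namespace DivAlg

variable {K ι : Type*} [CommRing K]

instance : AddCommGroup (DivAlg K ι) := inferInstanceAs (AddCommGroup ((ι → ℕ) →₀ K))

instance : Module K (DivAlg K ι) := inferInstanceAs (Module K ((ι → ℕ) →₀ K))

/-- The scalar multiple `u z^(a)` of a divided power monomial. -/
def monomial (a : ι → ℕ) (u : K) : DivAlg K ι := Finsupp.single a u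

/-- The coefficient of `f` at the monomial `z^(a)`. -/
def coeff (a : ι → ℕ) (f : DivAlg K ι) : K := (show (ι → ℕ) →₀ K from f) a

theorem smul_monomial (r : K) (a : ι → ℕ) (u : K) :
    r • monomial a u = monomial a (r * u) :=
  Finsupp.smul_single' r a u

theorem monomial_add (a : ι → ℕ) (u v : K) :
    monomial a (u + v) = monomial a u + monomial a v :=
  Finsupp.single_add a u v

theorem monomial_zero (a : ι → ℕ) : monomial a (0 : K) = 0 :=
  Finsupp.single_zero a

theorem induction_on {P : DivAlg K ι → Prop} (f : DivAlg K ι) (h0 : P 0)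
    (hadd : ∀ f g, P f → P g → P (f + g)) (hmon : ∀ a u, P (monomial a u)) : P f :=
  Finsupp.induction_linear (motive := P) f h0 (fun f g hf hg => hadd f g hf hg) hmon

/-- The `K`-linear map prescribed on the basis of divided power monomials. -/
def lift {V : Type*} [AddCommGroup V] [Module K V] (v : (ι → ℕ) → V) : DivAlg K ι →ₗ[K] V :=
  Finsupp.linearCombination K v

theorem lift_monomial {V : Type*} [AddCommGroup V] [Module K V] (v : (ι → ℕ) → V)
    (a : ι → ℕ) (u : K) : lift v (monomial a u) = u • v a :=
  Finsupp.linearCombination_single K u a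

/-- The structure constants `∏ i, binom (a i + b i) (a i)`. -/
def structConst [Fintype ι] (a b : ι → ℕ) : ℕ := ∏ i, (a i + b i).choose (a i)

theorem structConst_comm [Fintype ι] (a b : ι → ℕ) : structConst a b = structConst b a := by
  unfold structConst
  refine Finset.prod_congr rfl fun i _ => ?_
  rw [Nat.add_comm (b i), Nat.choose_symm_add]

theorem structConst_zero [Fintype ι] (a : ι → ℕ) : structConst 0 a = 1 := by
  simp [structConst]

theorem structConst_assoc [Fintype ι] (a b c : ι → ℕ) :
    structConst a b * structConst (a + b) c = structConst b c * structConst a (b + c) := by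
  unfold structConst
  rw [← Finset.prod_mul_distrib, ← Finset.prod_mul_distrib]
  refine Finset.prod_congr rfl fun i _ => ?_
  simp only [Pi.add_apply]
  have h := Nat.add_choose_mul_factorial_mul_factorial (a i) (b i)
  rw [← Nat.choose_symm_add] at h
  have h1 := Nat.add_choose_mul_factorial_mul_factorial (a i + b i) (c i)
  rw [← Nat.choose_symm_add] at h1
  have h2 := Nat.add_choose_mul_factorial_mul_factorial (b i) (c i)
  rw [← Nat.choose_symm_add] at h2
  have h3 := Nat.add_choose_mul_factorial_mul_factorial (a i) (b i + c i)
  rw [← Nat.choose_symm_add] at h3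
  rw [← add_assoc] at h3
  have hpos : 0 < (a i).factorial * (b i).factorial * (c i).factorial := by positivity
  refine Nat.eq_of_mul_eq_mul_right hpos ?_
  calc _ = ((a i + b i).choose (a i) * (a i).factorial * (b i).factorial) *
        (a i + b i + c i).choose (a i + b i) * (c i).factorial := by ring
    _ = (a i + b i + c i).factorial := by rw [h, ← h1]; ring
    _ = ((b i + c i).choose (b i) * (b i).factorial * (c i).factorial) *
        (a i + b i + c i).choose (a i) * (a i).factorial := by rw [h2, ← h3]; ring
    _ = _ := by rw [← add_assoc]; ring

/-- The bilinear multiplication with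
`z^(a) z^(b) = (∏ i, binom (a i + b i) (a i)) z^(a + b)`. -/
def mulLin [Fintype ι] : DivAlg K ι →ₗ[K] DivAlg K ι →ₗ[K] DivAlg K ι :=
  lift fun a => lift fun b => monomial (a + b) (structConst a b : K)

instance [Fintype ι] : Mul (DivAlg K ι) := ⟨fun f g => mulLin f g⟩

instance : One (DivAlg K ι) := ⟨monomial 0 1⟩

theorem one_def : (1 : DivAlg K ι) = monomial 0 1 := rfl

section Ring

variable [Fintype ι]

theorem mul_def (f g : DivAlg K ι) : f * g = mulLin f g := rfl

theorem monomial_mul (a b : ι → ℕ) (u v : K) :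
    monomial a u * monomial b v = monomial (a + b) (u * v * structConst a b) := by
  rw [mul_def, mulLin, lift_monomial, LinearMap.smul_apply, lift_monomial, smul_monomial,
    smul_monomial, mul_assoc]

protected theorem add_mul' (f g h : DivAlg K ι) : (f + g) * h = f * h + g * h := by
  simp [mul_def]

protected theorem mul_add' (f g h : DivAlg K ι) : f * (g + h) = f * g + f * h := by
  simp [mul_def]

protected theorem zero_mul' (f : DivAlg K ι) : 0 * f = 0 := by simp [mul_def]

protected theorem mul_zero' (f : DivAlg K ι) : f * 0 = 0 := by simp [mul_def]

protected theorem mul_comm' (f g : DivAlg K ι) : f * g = g * f := by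
  induction f using induction_on with
  | h0 => rw [DivAlg.zero_mul', DivAlg.mul_zero']
  | hadd f f' hf hf' => rw [DivAlg.add_mul', DivAlg.mul_add', hf, hf']
  | hmon a u =>
    induction g using induction_on with
    | h0 => rw [DivAlg.zero_mul', DivAlg.mul_zero']
    | hadd f f' hf hf' => rw [DivAlg.add_mul', DivAlg.mul_add', hf, hf']
    | hmon b v => rw [monomial_mul, monomial_mul, add_comm, structConst_comm, mul_comm u]

protected theorem mul_assoc' (f g h : DivAlg K ι) : f * g * h = f * (g * h) := by
  induction f using induction_on with
  | h0 => simp only [DivAlg.zero_mul']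
  | hadd f f' hf hf' => simp only [DivAlg.add_mul', hf, hf']
  | hmon a u =>
    induction g using induction_on with
    | h0 => simp only [DivAlg.zero_mul', DivAlg.mul_zero']
    | hadd f f' hf hf' => simp only [DivAlg.add_mul', DivAlg.mul_add', hf, hf']
    | hmon b v =>
      induction h using induction_on with
      | h0 => simp only [DivAlg.mul_zero']
      | hadd f f' hf hf' => simp only [DivAlg.mul_add', hf, hf']
      | hmon c w =>
        have h : (structConst a b : K) * structConst (a + b) c
            = structConst b c * structConst a (b + c) := by
          rw [← Nat.cast_mul, ← Nat.cast_mul, structConst_assoc]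
        simp only [monomial_mul, add_assoc]
        congr 1
        linear_combination u * v * w * h

protected theorem one_mul' (f : DivAlg K ι) : 1 * f = f := by
  induction f using induction_on with
  | h0 => rw [DivAlg.mul_zero']
  | hadd f f' hf hf' => rw [DivAlg.mul_add', hf, hf']
  | hmon a u => simp [one_def, monomial_mul, structConst_zero]

instance : CommRing (DivAlg K ι) :=
  { (inferInstance : AddCommGroup (DivAlg K ι)) with
    mul := (· * ·)
    one := 1
    left_distrib := DivAlg.mul_add'
    right_distrib := DivAlg.add_mul'
    zero_mul := DivAlg.zero_mul'
    mul_zero := DivAlg.mul_zero'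
    mul_assoc := DivAlg.mul_assoc'
    one_mul := DivAlg.one_mul'
    mul_one := fun f => by rw [DivAlg.mul_comm', DivAlg.one_mul']
    mul_comm := DivAlg.mul_comm' }

instance : Algebra K (DivAlg K ι) :=
  Algebra.ofModule (fun r f g => by simp [mul_def]) (fun r f g => by simp [mul_def])

end Ring

/-- The variable `z i = (z i)^(1)`. -/
def var [DecidableEq ι] (i : ι) : DivAlg K ι := monomial (Pi.single i 1) 1

/-- The partial derivative `d / d z i`, the linear map with
`(z i)^(l) ↦ (z i)^(l - 1)` for `l > 0`, `1 ↦ 0`, which is linear over the other variables. -/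
def deriv [DecidableEq ι] (i : ι) : DivAlg K ι →ₗ[K] DivAlg K ι :=
  lift fun a => if a i = 0 then 0 else monomial (Function.update a i (a i - 1)) 1

/-- The map induced by a permutation of the variables, `z i ↦ z (e i)`. -/
def permute (e : Equiv.Perm ι) : DivAlg K ι →ₗ[K] DivAlg K ι :=
  lift fun a => monomial (a ∘ e.symm) 1

/-- The homogeneous elements of degree `k` (zero only, if `k < 0`). -/
def homogeneous (K ι : Type*) [CommRing K] [Fintype ι] (k : ℤ) : Submodule K (DivAlg K ι) :=
  Submodule.span K {f | ∃ a : ι → ℕ, ((∑ i, a i : ℕ) : ℤ) = k ∧ f = monomial a 1}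

theorem mul_mem_homogeneous [Fintype ι] {k l : ℤ} {f g : DivAlg K ι}
    (hf : f ∈ homogeneous K ι k) (hg : g ∈ homogeneous K ι l) :
    f * g ∈ homogeneous K ι (k + l) := by
  refine Submodule.span_induction₂ (p := fun f g _ _ => f * g ∈ homogeneous K ι (k + l))
    ?_ ?_ ?_ ?_ ?_ ?_ ?_ hf hg
  · rintro _ _ ⟨a, ha, rfl⟩ ⟨b, hb, rfl⟩
    rw [monomial_mul, ← mul_one ((1 : K) * 1 * _), ← smul_monomial]
    refine Submodule.smul_mem _ _ (Submodule.subset_span ⟨a + b, ?_, rfl⟩)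
    simp only [Pi.add_apply, Finset.sum_add_distrib, Nat.cast_add, ha, hb]
  · intro g _; rw [zero_mul]; exact Submodule.zero_mem _
  · intro g _; rw [mul_zero]; exact Submodule.zero_mem _
  · intro _ _ _ _ _ _ h h'; rw [add_mul]; exact Submodule.add_mem _ h h'
  · intro _ _ _ _ _ _ h h'; rw [mul_add]; exact Submodule.add_mem _ h h'
  · intro r _ _ _ _ h; rw [smul_mul_assoc]; exact Submodule.smul_mem _ _ h
  · intro r _ _ _ _ h; rw [mul_smul_comm]; exact Submodule.smul_mem _ _ h

theorem permute_mul [Fintype ι] (e : Equiv.Perm ι) (f g : DivAlg K ι) :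
    permute e (f * g) = permute e f * permute e g := by
  induction f using induction_on with
  | h0 => simp
  | hadd f f' hf hf' => simp only [add_mul, map_add, hf, hf']
  | hmon a u =>
    induction g using induction_on with
    | h0 => simp
    | hadd f f' hf hf' => simp only [mul_add, map_add, hf, hf']
    | hmon b v =>
      have h : structConst (a ∘ e.symm) (b ∘ e.symm) = structConst a b :=
        Equiv.prod_comp e.symm fun i => (a i + b i).choose (a i)
      simp only [permute, lift_monomial, smul_monomial, monomial_mul, h, mul_one]
      rfl

/-- The Leibniz rule. -/
theorem deriv_mul [Fintype ι] [DecidableEq ι] (i : ι) (f g : DivAlg K ι) :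
    deriv i (f * g) = deriv i f * g + f * deriv i g := by
  induction f using induction_on with
  | h0 => simp
  | hadd f f' hf hf' => simp only [add_mul, map_add, hf, hf']; abel
  | hmon a u =>
    induction g using induction_on with
    | h0 => simp
    | hadd f f' hf hf' => simp only [mul_add, map_add, hf, hf']; abel
    | hmon b v =>
      have split : ∀ a b : ι → ℕ, structConst a b = (a i + b i).choose (a i) *
          ∏ j ∈ Finset.univ.erase i, (a j + b j).choose (a j) := fun a b =>
        (Finset.mul_prod_erase Finset.univ (fun j => (a j + b j).choose (a j))
          (Finset.mem_univ i)).symm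
      have rest : ∀ x y : ℕ, ∏ j ∈ Finset.univ.erase i,
          (Function.update a i x j + Function.update b i y j).choose (Function.update a i x j)
          = ∏ j ∈ Finset.univ.erase i, (a j + b j).choose (a j) := fun x y =>
        Finset.prod_congr rfl fun j hj => by
          simp [Function.update_of_ne (Finset.ne_of_mem_erase hj)]
      have key : ∀ x y : ℕ, structConst (Function.update a i x) (Function.update b i y)
          = (x + y).choose x * ∏ j ∈ Finset.univ.erase i, (a j + b j).choose (a j) :=
        fun x y => by rw [split, rest]; simp
      have upd : ∀ x y : ℕ, Function.update a i x + Function.update b i y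
          = Function.update (a + b) i (x + y) := fun x y => by
        rw [← Function.update_add]
      obtain ⟨x, hx⟩ : ∃ x, a i = x := ⟨_, rfl⟩
      obtain ⟨y, hy⟩ : ∃ y, b i = y := ⟨_, rfl⟩
      have ha : a = Function.update a i x := by rw [← hx, Function.update_eq_self]
      have hb : b = Function.update b i y := by rw [← hy, Function.update_eq_self]
      have k0 := key x y
      rw [← ha, ← hb] at k0
      have k1 := fun x' => key x' y
      have k2 := fun y' => key x y'
      have u1 := fun x' => upd x' y
      have u2 := fun y' => upd x y'
      simp only [← hb] at k1 u1
      simp only [← ha] at k2 u2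
      simp only [deriv, lift_monomial, monomial_mul, Pi.add_apply, hx, hy]
      rcases x with _ | x <;> rcases y with _ | y
      · simp
      · simp [smul_monomial, monomial_mul, u2, k2, k0]
      · simp [smul_monomial, monomial_mul, u1, k1, k0]
      · simp only [Nat.add_eq_zero_iff, Nat.succ_ne_zero, and_self, if_false, smul_monomial,
          monomial_mul, Nat.add_sub_cancel, u1, u2, k1, k2, k0, mul_one]
        rw [show x + 1 + (y + 1) - 1 = x + 1 + y by omega,
          show x + (y + 1) = x + 1 + y by omega, ← monomial_add,
          show (x + 1 + (y + 1)).choose (x + 1)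
            = (x + 1 + y).choose x + (x + 1 + y).choose (x + 1) from
              Nat.choose_succ_succ (x + 1 + y) x]
        push_cast
        congr 1
        ring

end DivAlg

/-- The algebra `Div[x_1, …, x_m | y_1, …, y_n]` over `K`: the variables `x` are indexed by the
left summand, the variables `y` by the right summand. -/
abbrev SuperDiv (K : Type*) [CommRing K] (m n : ℕ) : Type _ := DivAlg K (Fin m ⊕ Fin n)

namespace SuperDiv

variable {K : Type*} [CommRing K] {m n : ℕ}

/-- `f` is supersymmetric of degree `k`: it is homogeneous of degree `k`, symmetric in the `x`'s and
the `y`'s separately, and `(d/dx_1 + d/dy_1) f = (x_1 - y_1) f'` for some `f'` homogeneous of degree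
`k - 2`. -/
def IsSupersymmetricOfDegree [NeZero m] [NeZero n] (k : ℕ) (f : SuperDiv K m n) : Prop :=
  f ∈ DivAlg.homogeneous K (Fin m ⊕ Fin n) k ∧
  (∀ (σ : Equiv.Perm (Fin m)) (τ : Equiv.Perm (Fin n)),
    DivAlg.permute (Equiv.sumCongr σ τ) f = f) ∧
  ∃ f' ∈ DivAlg.homogeneous K (Fin m ⊕ Fin n) ((k : ℤ) - 2),
    DivAlg.deriv (Sum.inl 0) f + DivAlg.deriv (Sum.inr 0) f
      = (DivAlg.var (Sum.inl 0) - DivAlg.var (Sum.inr 0)) * f'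

/-- Supersymmetric elements (they are homogeneous by definition). -/
def IsSupersymmetric [NeZero m] [NeZero n] (f : SuperDiv K m n) : Prop :=
  ∃ k : ℕ, IsSupersymmetricOfDegree k f

theorem IsSupersymmetricOfDegree.mul [NeZero m] [NeZero n] {k l : ℕ} {f g : SuperDiv K m n}
    (hf : IsSupersymmetricOfDegree k f) (hg : IsSupersymmetricOfDegree l g) :
    IsSupersymmetricOfDegree (k + l) (f * g) := by
  obtain ⟨hf1, hf2, f', hf3, hf4⟩ := hf
  obtain ⟨hg1, hg2, g', hg3, hg4⟩ := hg
  refine ⟨?_, fun σ τ => by rw [DivAlg.permute_mul, hf2, hg2], f' * g + f * g', ?_, ?_⟩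
  · rw [Nat.cast_add]; exact DivAlg.mul_mem_homogeneous hf1 hg1
  · refine Submodule.add_mem _ ?_ ?_
    · have := DivAlg.mul_mem_homogeneous hf3 hg1
      rwa [show (k : ℤ) - 2 + l = ((k + l : ℕ) : ℤ) - 2 by push_cast; ring] at this
    · have := DivAlg.mul_mem_homogeneous hf1 hg3
      rwa [show (k : ℤ) + (l - 2) = ((k + l : ℕ) : ℤ) - 2 by push_cast; ring] at this
  · rw [DivAlg.deriv_mul, DivAlg.deriv_mul]
    linear_combination g * hf4 + f * hg4

theorem isSupersymmetricOfDegree_one [NeZero m] [NeZero n] :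
    IsSupersymmetricOfDegree 0 (1 : SuperDiv K m n) := by
  refine ⟨Submodule.subset_span ⟨0, by simp, rfl⟩, fun σ τ => ?_, 0, Submodule.zero_mem _, ?_⟩
  · rw [DivAlg.one_def, DivAlg.permute, DivAlg.lift_monomial, one_smul]
    rfl
  · simp [DivAlg.one_def, DivAlg.deriv, DivAlg.lift_monomial]

/-- The graded algebra of supersymmetric elements of `Div[x_1, …, x_m | y_1, …, y_n]`: all finite
sums of (homogeneous) supersymmetric elements. -/
def supersymmetricSubalgebra (K : Type*) [CommRing K] (m n : ℕ) [NeZero m] [NeZero n] :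
    Subalgebra K (SuperDiv K m n) :=
  Submodule.toSubalgebra (Submodule.span K {f : SuperDiv K m n | IsSupersymmetric f})
    (Submodule.subset_span ⟨0, isSupersymmetricOfDegree_one⟩)
    (fun f g hf hg => by
      have h := Submodule.mul_mem_mul hf hg
      rw [Submodule.span_mul_span] at h
      refine Submodule.span_mono ?_ h
      rintro _ ⟨a, ⟨k, ha⟩, b, ⟨l, hb⟩, rfl⟩
      exact ⟨k + l, ha.mul hb⟩)

/-- The lexicographic order on monomials, for `x_1 > … > x_m > y_1 > … > y_n`. -/
def lexLE (a b : Fin m ⊕ Fin n → ℕ) : Prop :=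
  toLex (toLex (a ∘ Sum.inl), toLex (a ∘ Sum.inr))
    ≤ toLex (toLex (b ∘ Sum.inl), toLex (b ∘ Sum.inr))

/-- The monomial with exponent `a` is the leading term of `f`. -/
def IsLeadingTerm (a : Fin m ⊕ Fin n → ℕ) (f : SuperDiv K m n) : Prop :=
  DivAlg.coeff a f ≠ 0 ∧ ∀ b, DivAlg.coeff b f ≠ 0 → lexLE b a

/-- For `j₁ ≥ j₂ ≥ 0`, the pair `(j₁, j₂)` has height one (relative to the prime `p`). -/
def HeightOne (p j₁ j₂ : ℕ) : Prop :=
  (j₁ < p - 1 ∧ j₂ = 0) ∨ j₁ % p = p - 1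

/-- The exponent of the monomial `x_1^(i) y_1^(j₁) y_2^(j₂)`. -/
def exponent (i j₁ j₂ : ℕ) : Fin 1 ⊕ Fin 2 → ℕ := Sum.elim ![i] ![j₁, j₂]

/-- The (exponents of the) symmetrized monomials `x_1^(p^s)` for `s > 0`, `x_1 y^(j₁, j₂)` with
`(j₁, j₂)` of height one, and `x_1^(2) y^(j₁, j₂)` with `(j₁, j₂)` of height greater than one. -/
def generatingMonomials (p : ℕ) : Set (Fin 1 ⊕ Fin 2 → ℕ) :=
  {a | (∃ s > 0, a = exponent (p ^ s) 0 0) ∨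
    (∃ j₁ j₂, j₂ ≤ j₁ ∧ HeightOne p j₁ j₂ ∧ a = exponent 1 j₁ j₂) ∨
    (∃ j₁ j₂, j₂ ≤ j₁ ∧ ¬ HeightOne p j₁ j₂ ∧ a = exponent 2 j₁ j₂)}

end SuperDiv

end

/-!
Write `c i j k` for the coefficient of `f` at `x_1^(i) y_1^(j) y_2^(k)`.

**Which leading terms occur.**  In the basis of divided power monomials in `u = x_1 - y_1`, `y_1`,
`y_2`, the derivation `D = d/dx_1 + d/dy_1` is `d/dy_1`, and since `u u^(a - 1) = a u^(a)`, a multiple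
of `u` has no terms with `u^(a)`, `p ∣ a` (`sum_choose_mul_cf_eq_zero`).  If `f` is supersymmetric and
`i ≤ a + 1` for all `x_1^(i)` in `f`, the vanishing of these coefficients of `D f` says
`c a (j + 1) k + (j + 1) c (a + 1) j k = 0` (`cf_add_mul_cf_eq_zero`).  So a leading exponent `i` of
`x_1` is prime to `p`, unless the leading term is `x_1^(i)`.  If `i = a + 1`, then by the symmetry of
`c a`, the coefficients `A = c (a + 1)` satisfy `(j + 1) A j (k + 1) = (k + 1) A (j + 1) k`, and this
recursion lets the top coefficient be nonzero only in height one (`heightOne_of_isLeadingTerm`).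

**Realising the listed monomials.**  `(x_1 - y_1 - y_2)^(d)` is killed by `D` and leads with `x_1^(d)`;
`(x_1 - y_1) (x_1 - y_2) g` with `g` symmetric in the `y`'s leads with `x_1^(2)`; and a symmetric
solution `A` of the recursion above extends to a supersymmetric `x_1 A + B`
(`exists_isSupersymmetric_of_linear`).  In height one such solutions are products of factorials.

**Generation.**  Leading terms multiply as long as the structure constant is nonzero in `K`
(`isLeadingTerm_mul`).  Splitting off powers `x_1^(p^s)` realises every `x_1^(i)` as a leading term
(`exists_not_dvd_choose_pow`), and then all leading terms that the restrictions leave, because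
`binom i 1` and `binom i 2` are prime to `p` for `i` not `0`, respectively not `0` or `1`, modulo `p`
(`exists_mem_leadingTerm`).  The usual subduction along the lexicographic order, which is a
well-order, finishes the proof (`mem_of_forall_leadingTerm`).
-/

noncomputable section

namespace DivAlg

section General

variable {K ι : Type*} [CommRing K]

/-! ### Coefficients -/

theorem ext_coeff {f g : DivAlg K ι} (h : ∀ a, coeff a f = coeff a g) : f = g :=
  Finsupp.ext h

theorem coeff_zero (a : ι → ℕ) : coeff a (0 : DivAlg K ι) = 0 := rfl

theorem coeff_add (a : ι → ℕ) (f g : DivAlg K ι) :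
    coeff a (f + g) = coeff a f + coeff a g := rfl

theorem coeff_sub (a : ι → ℕ) (f g : DivAlg K ι) :
    coeff a (f - g) = coeff a f - coeff a g := rfl

theorem coeff_smul (a : ι → ℕ) (r : K) (f : DivAlg K ι) :
    coeff a (r • f) = r * coeff a f := rfl

theorem coeff_monomial (a b : ι → ℕ) (u : K) [Decidable (b = a)] :
    coeff a (monomial b u) = if b = a then u else 0 := by
  rw [coeff, monomial]
  exact Finsupp.single_apply

theorem coeff_sum {α : Type*} (a : ι → ℕ) (s : Finset α) (f : α → DivAlg K ι) :
    coeff a (∑ i ∈ s, f i) = ∑ i ∈ s, coeff a (f i) :=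
  map_sum (⟨⟨coeff a, coeff_zero a⟩, coeff_add a⟩ : DivAlg K ι →+ K) f s

theorem coeff_deriv [DecidableEq ι] (i : ι) (a : ι → ℕ) (f : DivAlg K ι) :
    coeff a (deriv i f) = coeff (Function.update a i (a i + 1)) f := by
  classical
  induction f using induction_on with
  | h0 => simp [coeff_zero]
  | hadd f g hf hg => rw [map_add, coeff_add, coeff_add, hf, hg]
  | hmon b u =>
    rw [deriv, lift_monomial, coeff_smul]
    by_cases hb : b i = 0
    · rw [if_pos hb, coeff_zero, mul_zero, coeff_monomial, if_neg]
      rintro rfl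
      simp at hb
    · rw [if_neg hb, coeff_monomial, coeff_monomial, mul_ite, mul_one, mul_zero]
      congr 1
      refine propext ⟨?_, ?_⟩
      · rintro rfl
        simp [Nat.sub_add_cancel (Nat.pos_of_ne_zero hb)]
      · rintro rfl
        simp

theorem coeff_var_mul [Fintype ι] [DecidableEq ι] (i : ι) (a : ι → ℕ) (f : DivAlg K ι) :
    coeff a (var i * f) = a i * coeff (Function.update a i (a i - 1)) f := by
  induction f using induction_on with
  | h0 => simp [coeff_zero]
  | hadd f g hf hg => rw [mul_add, coeff_add, coeff_add, hf, hg, mul_add]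
  | hmon b u =>
    have hs : structConst (Pi.single i 1) b = b i + 1 := by
      rw [structConst, Finset.prod_eq_single i]
      · simp [add_comm]
      · intro j _ hj
        simp [Pi.single_eq_of_ne hj]
      · simp
    rw [var, monomial_mul, coeff_monomial, coeff_monomial, hs]
    by_cases h : Pi.single i 1 + b = a
    · have hb : b = Function.update a i (a i - 1) := by
        subst h
        ext j
        by_cases hj : j = i
        · subst hj; simp
        · simp [hj]
      rw [if_pos h, if_pos hb, ← h]
      simp only [Pi.add_apply, Pi.single_eq_same]
      push_cast
      ring
    · rw [if_neg h]
      split_ifs with hb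
      · have ha : a i = 0 := by
          by_contra ha
          refine h ?_
          subst hb
          ext j
          by_cases hj : j = i
          · subst hj
            simp
            omega
          · simp [hj]
        simp [ha]
      · simp

theorem coeff_permute (e : Equiv.Perm ι) (a : ι → ℕ) (f : DivAlg K ι) :
    coeff a (permute e f) = coeff (a ∘ e) f := by
  classical
  induction f using induction_on with
  | h0 => simp [coeff_zero]
  | hadd f g hf hg => rw [map_add, coeff_add, coeff_add, hf, hg]
  | hmon b u =>
    rw [permute, lift_monomial, smul_monomial, mul_one, coeff_monomial, coeff_monomial]
    simp only [Equiv.comp_symm_eq]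

theorem mem_homogeneous_iff [Fintype ι] {k : ℤ} {f : DivAlg K ι} :
    f ∈ homogeneous K ι k ↔ ∀ a, coeff a f ≠ 0 → ((∑ i, a i : ℕ) : ℤ) = k := by
  classical
  constructor
  · intro hf
    induction hf using Submodule.span_induction with
    | mem f hf =>
      obtain ⟨b, hb, rfl⟩ := hf
      intro a ha
      rw [coeff_monomial] at ha
      split_ifs at ha with h
      · rw [← h, hb]
      · exact absurd rfl ha
    | zero => exact fun a ha => absurd rfl ha
    | add f g _ _ hf hg =>
      intro a ha
      by_cases h : coeff a f = 0
      · refine hg a fun h' => ha ?_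
        rw [coeff_add, h, h', add_zero]
      · exact hf a h
    | smul r f _ hf =>
      intro a ha
      refine hf a fun h => ha ?_
      rw [coeff_smul, h, mul_zero]
  · intro h
    have key : f = ∑ a ∈ Finsupp.support (show (ι → ℕ) →₀ K from f), coeff a f • monomial a 1 := by
      simp only [smul_monomial, mul_one]
      exact (Finsupp.sum_single (show (ι → ℕ) →₀ K from f)).symm
    rw [key]
    refine Submodule.sum_mem _ fun a ha => Submodule.smul_mem _ _ (Submodule.subset_span ?_)
    exact ⟨a, h a (Finsupp.mem_support_iff.mp ha), rfl⟩

theorem deriv_mem_homogeneous [Fintype ι] [DecidableEq ι] {k : ℤ} {f : DivAlg K ι} (i : ι)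
    (hf : f ∈ homogeneous K ι k) : deriv i f ∈ homogeneous K ι (k - 1) := by
  rw [mem_homogeneous_iff] at hf ⊢
  intro a ha
  rw [coeff_deriv] at ha
  have h := hf _ ha
  rw [Finset.sum_update_of_mem (Finset.mem_univ i)] at h
  have h1 := Finset.add_sum_erase Finset.univ a (Finset.mem_univ i)
  rw [← Finset.sdiff_singleton_eq_erase] at h1
  rw [← h1]
  push_cast at h ⊢
  linarith

/-- The homogeneous element of degree `d` with coefficients `c a`; the values of `c` in the other
degrees are disregarded. -/
def ofCoeff [Fintype ι] [DecidableEq ι] (d : ℕ) (c : (ι → ℕ) → K) : DivAlg K ι :=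
  ∑ a ∈ Finset.piAntidiag Finset.univ d, monomial a (c a)

theorem coeff_ofCoeff [Fintype ι] [DecidableEq ι] (d : ℕ) (c : (ι → ℕ) → K) (a : ι → ℕ) :
    coeff a (ofCoeff d c) = if ∑ i, a i = d then c a else 0 := by
  simp [ofCoeff, coeff_sum, coeff_monomial]

theorem ofCoeff_mem_homogeneous [Fintype ι] [DecidableEq ι] (d : ℕ) (c : (ι → ℕ) → K) :
    ofCoeff d c ∈ homogeneous K ι d := by
  rw [mem_homogeneous_iff]
  intro a ha
  rw [coeff_ofCoeff] at ha
  split_ifs at ha with h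
  · rw [h]
  · exact absurd rfl ha

theorem coeff_mul [Fintype ι] [DecidableEq ι] (f g : DivAlg K ι) (c : ι → ℕ) :
    coeff c (f * g) = ∑ a ∈ Finsupp.support (show (ι → ℕ) →₀ K from f),
      ∑ b ∈ Finsupp.support (show (ι → ℕ) →₀ K from g),
        if a + b = c then coeff a f * coeff b g * structConst a b else 0 := by
  have key : ∀ f : DivAlg K ι,
      f = ∑ a ∈ Finsupp.support (show (ι → ℕ) →₀ K from f), monomial a (coeff a f) :=
    fun f => (Finsupp.sum_single (show (ι → ℕ) →₀ K from f)).symm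
  conv_lhs => rw [key f, key g]
  simp only [Finset.sum_mul_sum, coeff_sum, monomial_mul, coeff_monomial]

end General

end DivAlg

namespace SuperDiv

open DivAlg

/-! ### Coordinates for `m = 1`, `n = 2` -/

section Coordinates

variable {K : Type*} [CommRing K]

@[simp] theorem exponent_inl (i j k : ℕ) (x : Fin 1) : exponent i j k (Sum.inl x) = i := by
  simp [exponent]

@[simp] theorem exponent_inr_zero (i j k : ℕ) : exponent i j k (Sum.inr 0) = j := rfl

@[simp] theorem exponent_inr_one (i j k : ℕ) : exponent i j k (Sum.inr 1) = k := rfl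

theorem exponent_ext {a b : Fin 1 ⊕ Fin 2 → ℕ} (h : a (Sum.inl 0) = b (Sum.inl 0))
    (h0 : a (Sum.inr 0) = b (Sum.inr 0)) (h1 : a (Sum.inr 1) = b (Sum.inr 1)) : a = b := by
  ext x
  rcases x with x | x
  · rw [Subsingleton.elim x 0, h]
  · fin_cases x
    · exact h0
    · exact h1

theorem eq_exponent (a : Fin 1 ⊕ Fin 2 → ℕ) :
    a = exponent (a (Sum.inl 0)) (a (Sum.inr 0)) (a (Sum.inr 1)) :=
  exponent_ext rfl rfl rfl

@[simp] theorem exponent_inj {i j k i' j' k' : ℕ} :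
    exponent i j k = exponent i' j' k' ↔ i = i' ∧ j = j' ∧ k = k' := by
  refine ⟨fun h => ⟨congrFun h (Sum.inl 0), congrFun h (Sum.inr 0), congrFun h (Sum.inr 1)⟩, ?_⟩
  rintro ⟨rfl, rfl, rfl⟩
  rfl

theorem exponent_add (i j k i' j' k' : ℕ) :
    exponent i j k + exponent i' j' k' = exponent (i + i') (j + j') (k + k') :=
  exponent_ext rfl rfl rfl

theorem sum_exponent (i j k : ℕ) : ∑ x, exponent i j k x = i + j + k := by
  simp [add_assoc]

theorem update_x (i j k l : ℕ) :
    Function.update (exponent i j k) (Sum.inl 0) l = exponent l j k :=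
  exponent_ext (by simp) (by simp) (by simp)

theorem update_y₁ (i j k l : ℕ) :
    Function.update (exponent i j k) (Sum.inr 0) l = exponent i l k :=
  exponent_ext (by simp) (by simp) (by simp)

theorem update_y₂ (i j k l : ℕ) :
    Function.update (exponent i j k) (Sum.inr 1) l = exponent i j l :=
  exponent_ext (by simp) (by simp) (by simp)

theorem structConst_exponent (i j k i' j' k' : ℕ) :
    structConst (exponent i j k) (exponent i' j' k')
      = (i + i').choose i * ((j + j').choose j * (k + k').choose k) := by
  simp [structConst]

/-- The coefficient of `f` at `x_1^(i) y_1^(j) y_2^(k)`. -/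
def cf (f : SuperDiv K 1 2) (i j k : ℕ) : K := coeff (exponent i j k) f

theorem ext_cf {f g : SuperDiv K 1 2} (h : ∀ i j k, cf f i j k = cf g i j k) : f = g :=
  ext_coeff fun a => by rw [eq_exponent a]; exact h _ _ _

theorem cf_add (f g : SuperDiv K 1 2) (i j k : ℕ) : cf (f + g) i j k = cf f i j k + cf g i j k :=
  rfl

theorem cf_sub (f g : SuperDiv K 1 2) (i j k : ℕ) : cf (f - g) i j k = cf f i j k - cf g i j k :=
  rfl

theorem cf_zero (i j k : ℕ) : cf (0 : SuperDiv K 1 2) i j k = 0 := rfl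

theorem cf_deriv_x (f : SuperDiv K 1 2) (i j k : ℕ) :
    cf (deriv (Sum.inl 0) f) i j k = cf f (i + 1) j k := by
  rw [cf, coeff_deriv, update_x, exponent_inl, cf]

theorem cf_deriv_y₁ (f : SuperDiv K 1 2) (i j k : ℕ) :
    cf (deriv (Sum.inr 0) f) i j k = cf f i (j + 1) k := by
  rw [cf, coeff_deriv, update_y₁, exponent_inr_zero, cf]

theorem cf_x_mul (f : SuperDiv K 1 2) (i j k : ℕ) :
    cf (var (Sum.inl 0) * f) i j k = i * cf f (i - 1) j k := by
  rw [cf, coeff_var_mul, update_x, exponent_inl, cf]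

theorem cf_y₁_mul (f : SuperDiv K 1 2) (i j k : ℕ) :
    cf (var (Sum.inr 0) * f) i j k = j * cf f i (j - 1) k := by
  rw [cf, coeff_var_mul, update_y₁, exponent_inr_zero, cf]

theorem cf_y₂_mul (f : SuperDiv K 1 2) (i j k : ℕ) :
    cf (var (Sum.inr 1) * f) i j k = k * cf f i j (k - 1) := by
  rw [cf, coeff_var_mul, update_y₂, exponent_inr_one, cf]

theorem cf_ofCoeff (d : ℕ) (c : (Fin 1 ⊕ Fin 2 → ℕ) → K) (i j k : ℕ) :
    cf (ofCoeff d c) i j k = if i + j + k = d then c (exponent i j k) else 0 := by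
  rw [cf, coeff_ofCoeff, sum_exponent]

theorem cf_monomial (i j k i' j' k' : ℕ) (u : K) :
    cf (monomial (exponent i j k) u) i' j' k' = if i = i' ∧ j = j' ∧ k = k' then u else 0 := by
  rw [cf, coeff_monomial]
  simp only [exponent_inj]

theorem cf_permute_swap (f : SuperDiv K 1 2) (σ : Equiv.Perm (Fin 1)) (i j k : ℕ) :
    cf (permute (Equiv.sumCongr σ (Equiv.swap 0 1)) f) i j k = cf f i k j := by
  rw [cf, coeff_permute, cf]
  congr 1
  refine exponent_ext ?_ ?_ ?_ <;> simp

theorem mem_homogeneous_iff_cf {d : ℤ} {f : SuperDiv K 1 2} :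
    f ∈ homogeneous K (Fin 1 ⊕ Fin 2) d
      ↔ ∀ i j k, cf f i j k ≠ 0 → ((i + j + k : ℕ) : ℤ) = d := by
  rw [mem_homogeneous_iff]
  constructor
  · intro h i j k hc
    rw [← sum_exponent]
    exact h _ hc
  · intro h a
    rw [eq_exponent a, sum_exponent]
    exact h _ _ _

theorem forall_permute_eq_iff {f : SuperDiv K 1 2} :
    (∀ (σ : Equiv.Perm (Fin 1)) (τ : Equiv.Perm (Fin 2)), permute (Equiv.sumCongr σ τ) f = f)
      ↔ ∀ i j k, cf f i j k = cf f i k j := by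
  constructor
  · intro h i j k
    conv_lhs => rw [← h 1 (Equiv.swap 0 1)]
    exact cf_permute_swap f 1 i j k
  · intro h σ τ
    refine ext_cf fun i j k => ?_
    obtain rfl : σ = 1 := Subsingleton.elim _ _
    have hτ : ∀ τ : Equiv.Perm (Fin 2), τ = 1 ∨ τ = Equiv.swap 0 1 := by decide
    rcases hτ τ with rfl | rfl
    · rw [cf, coeff_permute, cf]
      congr 1
      exact exponent_ext rfl rfl rfl
    · rw [cf_permute_swap, h]

theorem lexLE_iff {a b : Fin 1 ⊕ Fin 2 → ℕ} :
    lexLE a b ↔ a (Sum.inl 0) < b (Sum.inl 0) ∨ (a (Sum.inl 0) = b (Sum.inl 0) ∧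
      (a (Sum.inr 0) < b (Sum.inr 0) ∨
        (a (Sum.inr 0) = b (Sum.inr 0) ∧ a (Sum.inr 1) ≤ b (Sum.inr 1)))) := by
  have h1 : toLex (a ∘ Sum.inl) < toLex (b ∘ Sum.inl) ↔ a (Sum.inl 0) < b (Sum.inl 0) := by
    rw [Pi.Lex.lt_iff_of_unique]
    rfl
  have h2 : toLex (a ∘ Sum.inl) = toLex (b ∘ Sum.inl) ↔ a (Sum.inl 0) = b (Sum.inl 0) := by
    rw [toLex_inj, funext_iff]
    simp
  have h3 : toLex (a ∘ Sum.inr) < toLex (b ∘ Sum.inr) ↔ a (Sum.inr 0) < b (Sum.inr 0) ∨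
      (a (Sum.inr 0) = b (Sum.inr 0) ∧ a (Sum.inr 1) < b (Sum.inr 1)) := by
    change (∃ x : Fin 2, (∀ y, y < x → a (Sum.inr y) = b (Sum.inr y)) ∧
      a (Sum.inr x) < b (Sum.inr x)) ↔ _
    simp [Fin.exists_fin_two, Fin.forall_fin_two]
  have h4 : toLex (a ∘ Sum.inr) = toLex (b ∘ Sum.inr) ↔
      a (Sum.inr 0) = b (Sum.inr 0) ∧ a (Sum.inr 1) = b (Sum.inr 1) := by
    rw [toLex_inj, funext_iff]
    simp [Fin.forall_fin_two]
  rw [lexLE, Prod.Lex.toLex_le_toLex]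
  have h5 := (le_iff_lt_or_eq (a := toLex (a ∘ Sum.inr)) (b := toLex (b ∘ Sum.inr))).trans
    (or_congr h3 h4)
  dsimp only
  rw [h1, h2, h5]
  omega

theorem isLeadingTerm_iff {i j k : ℕ} {f : SuperDiv K 1 2} :
    IsLeadingTerm (exponent i j k) f ↔ cf f i j k ≠ 0 ∧ ∀ i' j' k', cf f i' j' k' ≠ 0 →
      i' < i ∨ (i' = i ∧ (j' < j ∨ (j' = j ∧ k' ≤ k))) := by
  refine and_congr Iff.rfl ⟨fun h i' j' k' hc => lexLE_iff.mp (h _ hc), fun h b hb => ?_⟩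
  rw [eq_exponent b] at hb ⊢
  exact lexLE_iff.mpr (h _ _ _ hb)

theorem isSupersymmetricOfDegree_iff {d : ℕ} {f : SuperDiv K 1 2} :
    IsSupersymmetricOfDegree d f ↔
      (∀ i j k, cf f i j k ≠ 0 → i + j + k = d) ∧ (∀ i j k, cf f i j k = cf f i k j) ∧
      ∃ f' ∈ homogeneous K (Fin 1 ⊕ Fin 2) ((d : ℤ) - 2), ∀ i j k,
        cf f (i + 1) j k + cf f i (j + 1) k = i * cf f' (i - 1) j k - j * cf f' i (j - 1) k := by
  refine and_congr ?_ (and_congr forall_permute_eq_iff (exists_congr fun f' =>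
    and_congr Iff.rfl ⟨fun h i j k => ?_, fun h => ext_cf fun i j k => ?_⟩))
  · rw [mem_homogeneous_iff_cf]
    simp only [Nat.cast_inj]
  · rw [← cf_x_mul, ← cf_y₁_mul, ← cf_sub, ← sub_mul, ← h, cf_add, cf_deriv_x, cf_deriv_y₁]
  · rw [sub_mul, cf_sub, cf_x_mul, cf_y₁_mul, ← h, cf_add, cf_deriv_x, cf_deriv_y₁]

end Coordinates

/-! ### Restrictions on leading terms -/

section Restrictions

variable {K : Type*} [Field K] {p : ℕ} [CharP K p]

/-- If `p ∣ a`, then `g ↦ ∑ l, binom M l • (coefficient of g at x_1^(a + l) y_1^(M - l) y_2^(k))`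
kills the multiples `g = (x_1 - y_1) f'`.  With `u = x_1 - y_1`, this sum is the coefficient of `g` at
`u^(a) y_1^(M) y_2^(k)` in the basis of divided power monomials in `u`, `y_1`, `y_2`, and
`u u^(a - 1) = a u^(a) = 0`.  The proof is a telescoping of the sum. -/
theorem sum_choose_mul_cf_eq_zero {a : ℕ} (ha : p ∣ a) (f' : SuperDiv K 1 2) (M k : ℕ) :
    ∑ l ∈ Finset.range (M + 1), (M.choose l : K) *
      ((a + l : ℕ) * cf f' (a + l - 1) (M - l) k - (M - l : ℕ) * cf f' (a + l) (M - l - 1) k)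
      = 0 := by
  have ha' : (a : K) = 0 := (CharP.cast_eq_zero_iff K p a).mpr ha
  let G : ℕ → K := fun l => (M.choose l : K) * l * cf f' (a + l - 1) (M - l) k
  have hG : ∀ l ∈ Finset.range (M + 1), (M.choose l : K) *
      ((a + l : ℕ) * cf f' (a + l - 1) (M - l) k - (M - l : ℕ) * cf f' (a + l) (M - l - 1) k)
      = G l - G (l + 1) := by
    intro l _
    have h := congrArg (Nat.cast (R := K)) (Nat.choose_succ_right_eq M l)
    push_cast at h
    simp only [G]
    rw [show a + (l + 1) - 1 = a + l by omega, show M - (l + 1) = M - l - 1 by omega]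
    push_cast
    rw [ha']
    linear_combination cf f' (a + l) (M - l - 1) k * h
  rw [Finset.sum_congr rfl hG, Finset.sum_range_sub']
  simp [G]

/-- If the exponents of `x_1` in `f` are at most `a + 1`, where `p ∣ a`, then the coefficients at
`x_1^(a)` are determined by those at `x_1^(a + 1)`, except at the monomials free of `y_1`. -/
theorem cf_add_mul_cf_eq_zero {d a : ℕ} {f : SuperDiv K 1 2} (hf : IsSupersymmetricOfDegree d f)
    (ha : p ∣ a) (h0 : ∀ i j k, a + 1 < i → cf f i j k = 0) (j k : ℕ) :
    cf f a (j + 1) k + (j + 1) * cf f (a + 1) j k = 0 := by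
  obtain ⟨-, -, f', -, h⟩ := isSupersymmetricOfDegree_iff.mp hf
  have hs := sum_choose_mul_cf_eq_zero ha f' j k
  simp only [← h] at hs
  rcases j with _ | j
  · simp at hs
    simpa [add_comm] using hs
  · rw [Finset.sum_range_succ', Finset.sum_range_succ', Finset.sum_eq_zero] at hs
    · rw [h0 (a + (0 + 1) + 1) _ _ (by omega)] at hs
      simp at hs
      push_cast
      linear_combination hs
    · intro l _
      rw [h0 _ _ _ (by omega), h0 _ _ _ (by omega), add_zero, mul_zero]

theorem le_of_isLeadingTerm {d i j k : ℕ} {f : SuperDiv K 1 2}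
    (hf : IsSupersymmetricOfDegree d f) (hl : IsLeadingTerm (exponent i j k) f) : k ≤ j := by
  obtain ⟨-, hs, -⟩ := isSupersymmetricOfDegree_iff.mp hf
  obtain ⟨h1, h2⟩ := isLeadingTerm_iff.mp hl
  have := h2 i k j (by rwa [hs])
  omega

theorem not_dvd_of_isLeadingTerm {d i j k : ℕ} {f : SuperDiv K 1 2}
    (hf : IsSupersymmetricOfDegree d f) (hl : IsLeadingTerm (exponent i j k) f) (hj : j ≠ 0) :
    ¬ p ∣ i := by
  intro hi
  obtain ⟨h1, h2⟩ := isLeadingTerm_iff.mp hl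
  have h0 : ∀ i' j' k', i < i' → cf f i' j' k' = 0 := fun i' j' k' h => by
    by_contra hc
    have := h2 _ _ _ hc
    omega
  obtain ⟨j, rfl⟩ := Nat.exists_eq_succ_of_ne_zero hj
  have h := cf_add_mul_cf_eq_zero hf hi (fun i' j' k' h => h0 i' j' k' (by omega)) j k
  rw [h0 (i + 1) j k (by omega), mul_zero, add_zero] at h
  exact h1 h

/-- At exponents of `x_1` congruent to `1` modulo `p`, only pairs of height one occur. -/
theorem heightOne_of_isLeadingTerm (hp : p.Prime) {d a j k : ℕ} {f : SuperDiv K 1 2}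
    (hf : IsSupersymmetricOfDegree d f) (hl : IsLeadingTerm (exponent (a + 1) j k) f)
    (ha : p ∣ a) : HeightOne p j k := by
  have hcast : ∀ n : ℕ, (n : K) = 0 ↔ p ∣ n := CharP.cast_eq_zero_iff K p
  have hpos := hp.pos
  obtain ⟨h1, h2⟩ := isLeadingTerm_iff.mp hl
  have hrec := cf_add_mul_cf_eq_zero hf ha (fun i' j' k' h => by
    by_contra hc
    have := h2 _ _ _ hc
    omega)
  obtain ⟨-, hs, -⟩ := isSupersymmetricOfDegree_iff.mp hf
  -- symmetry of the coefficients at `x_1^(a)` turns into a recursion for those at `x_1^(a + 1)`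
  have key : ∀ j k : ℕ, ((j + 1 : ℕ) : K) * cf f (a + 1) j (k + 1)
      = ((k + 1 : ℕ) : K) * cf f (a + 1) (j + 1) k := by
    intro j k
    have e1 := hrec j (k + 1)
    have e2 := hrec k (j + 1)
    rw [hs a (k + 1), hs (a + 1) k] at e2
    push_cast
    linear_combination e1 - e2
  by_contra hH
  rw [HeightOne, not_or] at hH
  obtain ⟨hH1, hH2⟩ := hH
  rcases k with _ | k
  · -- now `j = p q + t` with `t < p - 1`, and the coefficients vanish from `(p q, t)` upwards
    set q := j / p with hq
    set t := j % p with ht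
    have hj : p * q + t = j := Nat.div_add_mod j p
    have htp : t < p := Nat.mod_lt j hpos
    have hq0 : 0 < p * q := Nat.mul_pos hpos (Nat.pos_of_ne_zero fun h => by
      rw [h] at hj
      omega)
    have hdvd : ∀ n, 0 < n → n < p → ((n : ℕ) : K) ≠ 0 := fun n h h' h0 =>
      absurd (Nat.le_of_dvd h ((hcast n).mp h0)) (by omega)
    have hz : ∀ s ≤ t, cf f (a + 1) (p * q + s) (t - s) = 0 := by
      intro s
      induction s with
      | zero =>
        intro _
        have e := key (p * q - 1) t
        rw [Nat.sub_add_cancel hq0, (hcast (p * q)).mpr (dvd_mul_right p q), zero_mul] at e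
        exact (mul_eq_zero.mp e.symm).resolve_left (hdvd _ (by omega) (by omega))
      | succ s ih =>
        intro hst
        have e := key (p * q + s) (t - (s + 1))
        rw [show t - (s + 1) + 1 = t - s by omega, ih (by omega), mul_zero] at e
        exact (mul_eq_zero.mp e.symm).resolve_left (hdvd _ (by omega) (by omega))
    have := hz t le_rfl
    rw [hj, Nat.sub_self] at this
    exact h1 this
  · have e := key j k
    have : cf f (a + 1) (j + 1) k = 0 := by
      by_contra hc
      have := h2 _ _ _ hc
      omega
    rw [this, mul_zero] at e
    obtain ⟨c, hc⟩ := (hcast _).mp ((mul_eq_zero.mp e).resolve_right h1)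
    refine hH2 ?_
    obtain ⟨c, rfl⟩ := Nat.exists_eq_succ_of_ne_zero (n := c) (by rintro rfl; omega)
    rw [show j = p - 1 + p * c by rw [Nat.mul_succ] at hc; omega, Nat.add_mul_mod_self_left,
      Nat.mod_eq_of_lt (by omega)]

end Restrictions

/-! ### Supersymmetric elements with prescribed leading terms -/

section Existence

variable {K : Type*} [Field K]

/-- The divided power `(x_1 - y_1 - y_2)^(d)` is supersymmetric, being killed by
`d/dx_1 + d/dy_1`. -/
theorem exists_leadingTerm_x (d : ℕ) :
    ∃ f : SuperDiv K 1 2, IsSupersymmetric f ∧ IsLeadingTerm (exponent d 0 0) f := by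
  refine ⟨ofCoeff d fun a => (-1) ^ (a (Sum.inr 0) + a (Sum.inr 1)), ⟨d,
    isSupersymmetricOfDegree_iff.mpr ⟨?_, ?_, 0, Submodule.zero_mem _, ?_⟩⟩,
    isLeadingTerm_iff.mpr ⟨?_, ?_⟩⟩
  · intro i j k h
    rw [cf_ofCoeff] at h
    by_contra hd
    rw [if_neg hd] at h
    exact h rfl
  · intro i j k
    simp only [cf_ofCoeff, exponent_inr_zero, exponent_inr_one]
    rw [add_right_comm, add_comm j k]
  · intro i j k
    simp only [cf_ofCoeff, exponent_inr_zero, exponent_inr_one, cf_zero, mul_zero, sub_zero]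
    rw [show i + (j + 1) + k = i + 1 + j + k by ring]
    split_ifs <;> ring
  · simp [cf_ofCoeff]
  · intro i j k h
    rw [cf_ofCoeff] at h
    split_ifs at h with hd
    · omega
    · exact absurd rfl h

/-- The supersymmetric elements `x_1 A + B` with `A`, `B` free of `x_1`.  Supersymmetry forces `B` to
agree with `-y_1 A` at the monomials that contain `y_1`; so `y_1 A` has to be symmetric at the
monomials that contain both `y_1` and `y_2`, which is the recursion, and at the pure powers of `y_2`
the symmetry of `B` prescribes its coefficient. -/
theorem exists_isSupersymmetric_of_linear {n : ℕ} {A : ℕ → ℕ → K} (hA : ∀ j k, A j k = A k j)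
    (hrec : ∀ j k, j + k + 1 = n →
      ((j + 1 : ℕ) : K) * A j (k + 1) = ((k + 1 : ℕ) : K) * A (j + 1) k) :
    ∃ f : SuperDiv K 1 2, IsSupersymmetric f ∧
      (∀ j k, j + k = n → cf f 1 j k = A j k) ∧ (∀ i j k, 1 < i → cf f i j k = 0) ∧
      ∀ j k, j + k ≠ n → cf f 1 j k = 0 := by
  -- the coefficients of `B` (first two lines) and `A`
  let c : ℕ → ℕ → ℕ → K
    | 0, 0, k => -k * A 0 (k - 1)
    | 0, j + 1, k => -(j + 1) * A j k
    | 1, j, k => A j k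
    | _ + 2, _, _ => 0
  let f : SuperDiv K 1 2 := ofCoeff (n + 1)
    fun a => c (a (Sum.inl 0)) (a (Sum.inr 0)) (a (Sum.inr 1))
  have hf : ∀ i j k, cf f i j k = if i + j + k = n + 1 then c i j k else 0 := by
    intro i j k
    simp only [f, cf_ofCoeff, exponent_inl, exponent_inr_zero, exponent_inr_one]
  -- `(d/dx_1 + d/dy_1) f = (x_1 - y_1) f'` for the derivative `f' = d/dy_1 A`
  let f' : SuperDiv K 1 2 := deriv (Sum.inr 0) (ofCoeff n
    fun a => if a (Sum.inl 0) = 0 then A (a (Sum.inr 0)) (a (Sum.inr 1)) else 0)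
  have hf' : ∀ i j k, cf f' i j k
      = if i = 0 ∧ j + 1 + k = n then A (j + 1) k else 0 := by
    intro i j k
    simp only [f', cf_deriv_y₁, cf_ofCoeff, exponent_inl, exponent_inr_zero, exponent_inr_one]
    by_cases hi : i = 0
    · subst hi; simp
    · simp [hi]
  refine ⟨f, ⟨n + 1, isSupersymmetricOfDegree_iff.mpr ⟨?_, ?_, f', ?_, ?_⟩⟩, ?_, ?_, ?_⟩
  · intro i j k h
    rw [hf] at h
    by_contra hd
    rw [if_neg hd] at h
    exact h rfl
  · intro i j k
    rw [hf, hf, add_right_comm]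
    split_ifs with hd
    · rcases i with _ | _ | i
      · rcases j with _ | j <;> rcases k with _ | k
        · rfl
        · simp only [c, Nat.add_sub_cancel]
          rw [hA 0 k]
          push_cast
          ring
        · simp only [c, Nat.add_sub_cancel]
          rw [hA 0 j]
          push_cast
          ring
        · simp only [c]
          have := hrec j k (by omega)
          push_cast at this
          rw [hA k (j + 1)]
          linear_combination -this
      · exact hA j k
      · rfl
    · rfl
  · have := deriv_mem_homogeneous (Sum.inr 0) (ofCoeff_mem_homogeneous n (K := K)
      fun a : Fin 1 ⊕ Fin 2 → ℕ =>
        if a (Sum.inl 0) = 0 then A (a (Sum.inr 0)) (a (Sum.inr 1)) else 0)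
    rwa [show (n : ℤ) - 1 = ((n + 1 : ℕ) : ℤ) - 2 by push_cast; ring] at this
  · intro i j k
    rw [hf, hf, hf', hf']
    rw [show i + (j + 1) + k = i + 1 + j + k by ring]
    rcases i with _ | _ | i
    · rw [Nat.cast_zero, zero_mul, zero_sub]
      by_cases hd : j + k = n
      · rw [if_pos (by omega), if_pos (by omega)]
        rcases j with _ | j
        · simp [c]
        · rw [if_pos ⟨rfl, by omega⟩]
          simp only [c, Nat.add_sub_cancel]
          push_cast
          ring
      · rw [if_neg (by omega), if_neg (by omega)]
        rcases j with _ | j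
        · simp
        · rw [if_neg (by omega)]
          simp
    · simp only [c]
      rw [if_neg (by omega : ¬ (0 + 1 = 0 ∧ j - 1 + 1 + k = n))]
      have e : 0 + 1 + 1 + j + k = n + 1 ↔ j + 1 + k = n := by omega
      simp [e]
    · simp [c]
  · intro j k h
    rw [hf, if_pos (by omega)]
  · intro i j k h
    obtain ⟨i, rfl⟩ : ∃ l, i = l + 2 := ⟨i - 2, by omega⟩
    rw [hf]
    simp [c]
  · intro j k h
    rw [hf, if_neg (by omega)]

theorem exists_leadingTerm_of_recursion {j₁ j₂ : ℕ} {A : ℕ → ℕ → K}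
    (hA : ∀ j k, A j k = A k j)
    (hrec : ∀ j k, j + k + 1 = j₁ + j₂ →
      ((j + 1 : ℕ) : K) * A j (k + 1) = ((k + 1 : ℕ) : K) * A (j + 1) k)
    (h0 : A j₁ j₂ ≠ 0) (hlt : ∀ j k, j + k = j₁ + j₂ → j₁ < j → A j k = 0) :
    ∃ f : SuperDiv K 1 2, IsSupersymmetric f ∧ IsLeadingTerm (exponent 1 j₁ j₂) f := by
  obtain ⟨f, hf, h1, h2, h3⟩ := exists_isSupersymmetric_of_linear hA hrec
  refine ⟨f, hf, isLeadingTerm_iff.mpr ⟨by rwa [h1 _ _ rfl], fun i j k h => ?_⟩⟩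
  have hi : ¬ 1 < i := fun hi => h (h2 i j k hi)
  by_cases hi1 : i = 1
  · subst hi1
    have hn : j + k = j₁ + j₂ := by
      by_contra hn
      exact h (h3 j k hn)
    have hj : ¬ j₁ < j := fun hj => h (by rw [h1 j k hn, hlt j k hn hj])
    omega
  · omega

/-- For `j₁ < p - 1` and `j₂ = 0` the element is `x_1 h_n - h_{n+1}` with
`n = j₁` and `h_n` the complete symmetric polynomial in `y_1`, `y_2`.  For `j₁ = p q + p - 1` it is
`(x_1 - y_1) A` with `A` a multiple of `(y_1 - y_2)^(p - 1)`, so that `(y_1 - y_2) A = 0`. -/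
theorem exists_leadingTerm_heightOne {p : ℕ} [CharP K p] (hp : p.Prime) {j₁ j₂ : ℕ}
    (hj : j₂ ≤ j₁) (hH : HeightOne p j₁ j₂) :
    ∃ f : SuperDiv K 1 2, IsSupersymmetric f ∧ IsLeadingTerm (exponent 1 j₁ j₂) f := by
  have hcast : ∀ n : ℕ, (n : K) = 0 ↔ p ∣ n := CharP.cast_eq_zero_iff K p
  have hpos := hp.pos
  have hfac : ∀ n < p, ((n.factorial : ℕ) : K) ≠ 0 := fun n hn h =>
    absurd ((hp.dvd_factorial).mp ((hcast _).mp h)) (by omega)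
  rcases hH with ⟨h1, rfl⟩ | h1
  · refine exists_leadingTerm_of_recursion (A := fun j k => (j.factorial * k.factorial : ℕ))
      (fun j k => by rw [mul_comm]) (fun j k _ => ?_) ?_ (fun j k h h' => by omega)
    · rw [← Nat.cast_mul, ← Nat.cast_mul]
      congr 1
      rw [Nat.factorial_succ, Nat.factorial_succ]
      ring
    · simpa using hfac j₁ (by omega)
  · -- the part of degree `j₁ + j₂` of `A` is supported on two mirror blocks of side `p`
    refine exists_leadingTerm_of_recursion (A := fun j k =>
      if p - 1 ≤ j % p + k % p ∧ (j / p = j₁ / p ∧ k / p = j₂ / p ∨ j / p = j₂ / p ∧ k / p = j₁ / p)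
      then (((j % p).factorial * (k % p).factorial : ℕ) : K) else 0) ?_ ?_ ?_ ?_
    · intro j k
      rw [mul_comm, add_comm (j % p)]
      congr 1
      refine propext ?_
      tauto
    · intro j k _
      -- the quotient and the remainder of `j + 1`
      have hsucc : ∀ j : ℕ, (j % p < p - 1 ∧ (j + 1) % p = j % p + 1 ∧ (j + 1) / p = j / p) ∨
          (j % p = p - 1 ∧ (j + 1) % p = 0 ∧ ((j + 1 : ℕ) : K) = 0) := by
        intro j
        have hlt := Nat.mod_lt j hpos
        rcases Nat.lt_or_ge (j % p) (p - 1) with h | h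
        · left
          have e := Nat.div_add_mod j p
          refine ⟨h, ?_, ?_⟩
          · conv_lhs => rw [← e, add_assoc, Nat.mul_add_mod, Nat.mod_eq_of_lt (by omega)]
          · conv_lhs => rw [← e, add_assoc, Nat.mul_add_div hpos, Nat.div_eq_of_lt
              (show j % p + 1 < p by omega), add_zero]
        · right
          have hd : p ∣ j + 1 := ⟨j / p + 1, by
            have e := Nat.div_add_mod j p
            rw [Nat.mul_succ]
            omega⟩
          exact ⟨by omega, Nat.mod_eq_zero_of_dvd hd, (hcast _).mpr hd⟩
      have hmod : ∀ j : ℕ, ((j + 1 : ℕ) : K) = ((j % p + 1 : ℕ) : K) := by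
        intro j
        push_cast
        rw [CharP.cast_eq_mod K p j]
      rcases hsucc j with ⟨hj1, hj2, hj3⟩ | ⟨hj1, hj2, hj3⟩ <;>
        rcases hsucc k with ⟨hk1, hk2, hk3⟩ | ⟨hk1, hk2, hk3⟩
      · rw [hmod j, hmod k, hj2, hj3, hk2, hk3]
        rw [show j % p + 1 + k % p = j % p + (k % p + 1) by ring]
        split_ifs
        · rw [← Nat.cast_mul, ← Nat.cast_mul]
          congr 1
          rw [Nat.factorial_succ, Nat.factorial_succ]
          ring
        · simp
      · rw [hk3, zero_mul, if_neg (by omega), mul_zero]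
      · rw [hj3, zero_mul, if_neg (by omega), mul_zero]
      · rw [hj3, hk3, zero_mul, zero_mul]
    · have := Nat.mod_lt j₂ hpos
      rw [if_pos ⟨by omega, Or.inl ⟨rfl, rfl⟩⟩, Nat.cast_mul]
      exact mul_ne_zero (hfac _ (by omega)) (hfac _ this)
    · intro j k _ h'
      rw [if_neg]
      rintro ⟨-, h⟩
      have hle : j / p ≤ j₁ / p := by
        rcases h with ⟨h, -⟩ | ⟨h, -⟩
        · exact h.le
        · exact h.le.trans (Nat.div_le_div_right hj)
      have e := Nat.div_add_mod j p
      have e1 := Nat.div_add_mod j₁ p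
      have hlt := Nat.mod_lt j hpos
      have := Nat.mul_le_mul_left p hle
      omega

/-- The product of `(x_1 - y_1) (x_1 - y_2)` with a symmetric homogeneous element in `y_1`, `y_2` is
supersymmetric. -/
theorem exists_leadingTerm_two {j₁ j₂ : ℕ} (h2 : (2 : K) ≠ 0) (hj : j₂ ≤ j₁) :
    ∃ f : SuperDiv K 1 2, IsSupersymmetric f ∧ IsLeadingTerm (exponent 2 j₁ j₂) f := by
  let g : SuperDiv K 1 2 := monomial (exponent 0 j₁ j₂) 1 + monomial (exponent 0 j₂ j₁) 1
  let X : SuperDiv K 1 2 := var (Sum.inl 0)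
  let Y₁ : SuperDiv K 1 2 := var (Sum.inr 0)
  let Y₂ : SuperDiv K 1 2 := var (Sum.inr 1)
  have hg : ∀ i j k, cf g i j k = (if 0 = i ∧ j₁ = j ∧ j₂ = k then 1 else 0)
      + if 0 = i ∧ j₂ = j ∧ j₁ = k then 1 else 0 := by
    intro i j k
    rw [cf_add, cf_monomial, cf_monomial]
  have hdeg : g ∈ homogeneous K (Fin 1 ⊕ Fin 2) ((j₁ + j₂ : ℕ) : ℤ) := by
    refine Submodule.add_mem _ (Submodule.subset_span ⟨_, ?_, rfl⟩)
      (Submodule.subset_span ⟨_, ?_, rfl⟩) <;> rw [sum_exponent] <;> push_cast <;> ring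
  have hvar : ∀ i, (var i : SuperDiv K 1 2) ∈ homogeneous K (Fin 1 ⊕ Fin 2) 1 := fun i =>
    Submodule.subset_span ⟨_, by simp, rfl⟩
  have hd2 := mul_mem_homogeneous (Submodule.sub_mem _ (hvar (Sum.inl 0)) (hvar (Sum.inr 1))) hdeg
  have hd1 := mul_mem_homogeneous (Submodule.sub_mem _ (hvar (Sum.inl 0)) (hvar (Sum.inr 0))) hd2
  have hsymm : ∀ i j k, cf g i j k = cf g i k j := by
    intro i j k
    rw [hg, hg, add_comm]
    simp only [and_comm (a := j₁ = _)]
  have hcf : ∀ i j k, cf ((X - Y₁) * ((X - Y₂) * g)) i j k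
      = i * (((i - 1 : ℕ) : K) * cf g (i - 1 - 1) j k - k * cf g (i - 1) j (k - 1))
        - j * (i * cf g (i - 1) (j - 1) k - k * cf g i (j - 1) (k - 1)) := by
    intro i j k
    simp only [X, Y₁, Y₂, sub_mul, cf_sub, cf_x_mul, cf_y₁_mul, cf_y₂_mul]
  refine ⟨(X - Y₁) * ((X - Y₂) * g), ⟨j₁ + j₂ + 2, ?_, ?_,
    deriv (Sum.inl 0) ((X - Y₂) * g) + deriv (Sum.inr 0) ((X - Y₂) * g), ?_, ?_⟩,
    isLeadingTerm_iff.mpr ⟨?_, ?_⟩⟩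
  · rwa [show ((j₁ + j₂ + 2 : ℕ) : ℤ) = 1 + (1 + (j₁ + j₂ : ℕ)) by push_cast; ring]
  · refine forall_permute_eq_iff.mpr fun i j k => ?_
    rw [hcf, hcf, hsymm _ j k, hsymm _ j (k - 1), hsymm _ (j - 1) k, hsymm _ (j - 1) (k - 1)]
    ring
  · have := Submodule.add_mem _ (deriv_mem_homogeneous (Sum.inl 0) hd2)
      (deriv_mem_homogeneous (Sum.inr 0) hd2)
    rwa [show (1 : ℤ) + (j₁ + j₂ : ℕ) - 1 = ((j₁ + j₂ + 2 : ℕ) : ℤ) - 2 by push_cast; ring] at this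
  · have hxy : deriv (Sum.inl 0) (X - Y₁) + deriv (Sum.inr 0) (X - Y₁) = 0 := by
      refine ext_cf fun i j k => ?_
      rw [← mul_one (X - Y₁), sub_mul]
      simp only [X, Y₁, map_sub, cf_add, cf_sub, cf_deriv_x, cf_deriv_y₁, cf_x_mul, cf_y₁_mul,
        cf_zero]
      rw [one_def, show (0 : Fin 1 ⊕ Fin 2 → ℕ) = exponent 0 0 0 from exponent_ext rfl rfl rfl]
      simp only [cf_monomial]
      rcases i with _ | i <;> rcases j with _ | j <;> simp
    rw [DivAlg.deriv_mul (Sum.inl 0) (X - Y₁), DivAlg.deriv_mul (Sum.inr 0) (X - Y₁)]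
    linear_combination ((X - Y₂) * g) * hxy
  · rw [hcf, hg, hg, hg, hg]
    by_cases h : j₁ = j₂
    · subst h
      norm_num
      intro h4
      exact h2 (by
        have : (2 : K) * 2 = 0 := by linear_combination h4
        simpa using this)
    · simpa [h, Ne.symm h] using h2
  · intro i j k h
    by_contra hlt
    refine h ?_
    rw [hcf, hg, hg, hg, hg]
    have hi : 2 < i ∨ (i = 2 ∧ (j₁ < j ∨ (j = j₁ ∧ j₂ < k))) := by omega
    rcases hi with hi | ⟨rfl, hi⟩
    · simp only [show ¬ (0 = i - 1 - 1) by omega, show ¬ (0 = i - 1) by omega,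
        show ¬ (0 = i) by omega, false_and, if_false]
      ring
    · have h1 : ¬ (j₁ = j ∧ j₂ = k) := by omega
      have h2 : ¬ (j₂ = j ∧ j₁ = k) := by omega
      simp [h1, h2]

end Existence

/-! ### Leading terms and generation -/

section Generation

variable {K : Type*} [Field K]

theorem isLeadingTerm_mul {a b : Fin 1 ⊕ Fin 2 → ℕ} {f g : SuperDiv K 1 2}
    (hf : IsLeadingTerm a f) (hg : IsLeadingTerm b g) (hs : (structConst a b : K) ≠ 0) :
    IsLeadingTerm (a + b) (f * g) := by
  have hmem : ∀ (f : SuperDiv K 1 2) c,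
      c ∈ Finsupp.support (show (Fin 1 ⊕ Fin 2 → ℕ) →₀ K from f) ↔ coeff c f ≠ 0 := fun f c =>
    Finsupp.mem_support_iff
  constructor
  · have heq : ∀ a' b', coeff a' f ≠ 0 → coeff b' g ≠ 0 → a' + b' = a + b → a' = a ∧ b' = b := by
      intro a' b' ha' hb' h
      have h1 := lexLE_iff.mp (hf.2 a' ha')
      have h2 := lexLE_iff.mp (hg.2 b' hb')
      have e := fun x => congrFun h x
      simp only [Pi.add_apply] at e
      have e1 := e (Sum.inl 0)
      have e2 := e (Sum.inr 0)
      have e3 := e (Sum.inr 1)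
      exact ⟨exponent_ext (by omega) (by omega) (by omega),
        exponent_ext (by omega) (by omega) (by omega)⟩
    rw [coeff_mul, Finset.sum_eq_single a, Finset.sum_eq_single b, if_pos rfl]
    · exact mul_ne_zero (mul_ne_zero hf.1 hg.1) hs
    · intro b' hb' hne
      rw [if_neg fun h => hne (heq a b' hf.1 ((hmem _ _).mp hb') h).2]
    · intro hb
      exact absurd ((hmem _ _).mpr hg.1) hb
    · intro a' ha' hne
      refine Finset.sum_eq_zero fun b' hb' => ?_
      rw [if_neg fun h => hne (heq a' b' ((hmem _ _).mp ha') ((hmem _ _).mp hb') h).1]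
    · intro ha
      exact absurd ((hmem _ _).mpr hf.1) ha
  · intro c hc
    rw [coeff_mul] at hc
    obtain ⟨a', ha', hc⟩ := Finset.exists_ne_zero_of_sum_ne_zero hc
    obtain ⟨b', hb', hc⟩ := Finset.exists_ne_zero_of_sum_ne_zero hc
    have h1 := lexLE_iff.mp (hf.2 a' ((hmem _ _).mp ha'))
    have h2 := lexLE_iff.mp (hg.2 b' ((hmem _ _).mp hb'))
    split_ifs at hc with h
    · subst h
      rw [lexLE_iff]
      simp only [Pi.add_apply]
      omega
    · exact absurd rfl hc

theorem exists_isLeadingTerm {f : SuperDiv K 1 2} (hf : f ≠ 0) : ∃ a, IsLeadingTerm a f := by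
  have hne : (Finsupp.support (show (Fin 1 ⊕ Fin 2 → ℕ) →₀ K from f)).Nonempty :=
    Finsupp.support_nonempty_iff.mpr hf
  obtain ⟨a, ha, hmax⟩ := Finset.exists_max_image _
    (fun a : Fin 1 ⊕ Fin 2 → ℕ => toLex (toLex (a ∘ Sum.inl), toLex (a ∘ Sum.inr))) hne
  exact ⟨a, Finsupp.mem_support_iff.mp ha, fun b hb => hmax b (Finsupp.mem_support_iff.mpr hb)⟩

theorem IsSupersymmetric.mul {f g : SuperDiv K 1 2} (hf : IsSupersymmetric f)
    (hg : IsSupersymmetric g) : IsSupersymmetric (f * g) := by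
  obtain ⟨k, hf⟩ := hf
  obtain ⟨l, hg⟩ := hg
  exact ⟨k + l, hf.mul hg⟩

theorem IsSupersymmetricOfDegree.sub_smul {d : ℕ} {f g : SuperDiv K 1 2}
    (hf : IsSupersymmetricOfDegree d f) (hg : IsSupersymmetricOfDegree d g) (c : K) :
    IsSupersymmetricOfDegree d (f - c • g) := by
  obtain ⟨hf1, hf2, f', hf3, hf4⟩ := hf
  obtain ⟨hg1, hg2, g', hg3, hg4⟩ := hg
  refine ⟨Submodule.sub_mem _ hf1 (Submodule.smul_mem _ c hg1), fun σ τ => ?_, f' - c • g',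
    Submodule.sub_mem _ hf3 (Submodule.smul_mem _ c hg3), ?_⟩
  · rw [map_sub, map_smul, hf2, hg2]
  · rw [map_sub, map_sub, map_smul, map_smul, mul_sub, mul_smul_comm, ← hf4, ← hg4, smul_add]
    abel

/-- Subduction: a subalgebra that realises every leading term of a supersymmetric element contains
all supersymmetric elements. -/
theorem mem_of_forall_leadingTerm {B : Subalgebra K (SuperDiv K 1 2)}
    (hB : ∀ (a) (f : SuperDiv K 1 2), IsSupersymmetric f → IsLeadingTerm a f →
      ∃ g ∈ B, IsSupersymmetric g ∧ IsLeadingTerm a g)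
    {f : SuperDiv K 1 2} (hf : IsSupersymmetric f) : f ∈ B := by
  obtain ⟨d, hf⟩ := hf
  have main : ∀ a, ∀ f : SuperDiv K 1 2, IsSupersymmetricOfDegree d f → IsLeadingTerm a f →
      f ∈ B := by
    intro a
    have hwf : WellFounded fun a b : Fin 1 ⊕ Fin 2 → ℕ =>
        toLex (toLex (a ∘ Sum.inl), toLex (a ∘ Sum.inr))
          < toLex (toLex (b ∘ Sum.inl), toLex (b ∘ Sum.inr)) :=
      InvImage.wf _ wellFounded_lt
    induction a using hwf.induction with
    | _ a ih =>
      intro f hf hl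
      obtain ⟨g, hgB, ⟨e, hg⟩, hgl⟩ := hB a f ⟨d, hf⟩ hl
      have hde : (e : ℤ) = d := by
        rw [← mem_homogeneous_iff.mp hg.1 a hgl.1, ← mem_homogeneous_iff.mp hf.1 a hl.1]
      obtain rfl : e = d := by exact_mod_cast hde
      set c : K := coeff a f / coeff a g with hc
      have hcoeff : coeff a (f - c • g) = 0 := by
        rw [coeff_sub, coeff_smul, hc, div_mul_cancel₀ _ hgl.1, sub_self]
      suffices h : f - c • g ∈ B by
        have := B.add_mem h (B.smul_mem hgB c)
        rwa [sub_add_cancel] at this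
      by_cases h0 : f - c • g = 0
      · rw [h0]
        exact B.zero_mem
      · obtain ⟨b, hb⟩ := exists_isLeadingTerm h0
        refine ih b ?_ _ (hf.sub_smul hg c) hb
        have hba : lexLE b a := by
          by_cases hbf : coeff b f = 0
          · refine hgl.2 b fun hbg => hb.1 ?_
            rw [coeff_sub, coeff_smul, hbf, hbg, mul_zero, sub_zero]
          · exact hl.2 b hbf
        refine lt_of_le_of_ne hba fun h => hb.1 ?_
        have h1 := lexLE_iff.mp hba
        have h2 := lexLE_iff.mp (h.symm.le : lexLE a b)
        rw [exponent_ext (a := b) (b := a) (by omega) (by omega) (by omega), hcoeff]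
  by_cases h0 : f = 0
  · rw [h0]
    exact B.zero_mem
  · obtain ⟨a, ha⟩ := exists_isLeadingTerm h0
    exact main a f hf ha

/-- Every nonzero exponent `n` splits off a power `p ^ s` without the binomial coefficient vanishing
modulo `p`: by Lucas' theorem, the exponent `s` of `p` in `n` will do. -/
theorem exists_not_dvd_choose_pow {p : ℕ} (hp : p.Prime) (n : ℕ) (hn : n ≠ 0) :
    ∃ s, p ^ s ≤ n ∧ ¬ p ∣ n.choose (p ^ s) := by
  have := Fact.mk hp
  induction n using Nat.strong_induction_on with
  | _ n ih =>
    by_cases h : p ∣ n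
    · obtain ⟨q, rfl⟩ := h
      have hq : q ≠ 0 := by rintro rfl; exact hn (mul_zero p)
      obtain ⟨s, hs1, hs2⟩ := ih q (by
        have := Nat.mul_le_mul_right q hp.two_le
        omega) hq
      refine ⟨s + 1, ?_, fun hd => hs2 ?_⟩
      · rw [pow_succ']
        exact Nat.mul_le_mul_left p hs1
      · have hL := Choose.choose_modEq_choose_mod_mul_choose_div_nat (n := p * q)
          (k := p ^ (s + 1)) (p := p)
        rw [pow_succ', Nat.mul_mod_right, Nat.mul_mod_right, Nat.mul_div_cancel_left _ hp.pos,
          Nat.mul_div_cancel_left _ hp.pos, Nat.choose_self, one_mul, ← pow_succ'] at hL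
        exact (hL.dvd_iff dvd_rfl).mp hd
    · exact ⟨0, by rw [pow_zero]; omega, by rwa [pow_zero, Nat.choose_one_right]⟩

/-- The set of leading terms realised in `B` by supersymmetric elements is closed under those
products of divided power monomials that do not vanish. -/
theorem exists_mem_leadingTerm_mul {B : Subalgebra K (SuperDiv K 1 2)}
    {a b : Fin 1 ⊕ Fin 2 → ℕ} (ha : ∃ g ∈ B, IsSupersymmetric g ∧ IsLeadingTerm a g)
    (hb : ∃ g ∈ B, IsSupersymmetric g ∧ IsLeadingTerm b g) (hs : (structConst a b : K) ≠ 0) :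
    ∃ g ∈ B, IsSupersymmetric g ∧ IsLeadingTerm (a + b) g := by
  obtain ⟨f, hfB, hf, hfl⟩ := ha
  obtain ⟨g, hgB, hg, hgl⟩ := hb
  exact ⟨f * g, B.mul_mem hfB hgB, hf.mul hg, isLeadingTerm_mul hfl hgl hs⟩

theorem exists_mem_leadingTerm {p : ℕ} [CharP K p] (hp : p.Prime) (hp2 : 2 < p)
    {B : Subalgebra K (SuperDiv K 1 2)}
    (hB : ∀ M ∈ generatingMonomials p, ∃ g ∈ B, IsSupersymmetric g ∧ IsLeadingTerm M g)
    (a : Fin 1 ⊕ Fin 2 → ℕ) (f : SuperDiv K 1 2) (hf : IsSupersymmetric f)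
    (hl : IsLeadingTerm a f) : ∃ g ∈ B, IsSupersymmetric g ∧ IsLeadingTerm a g := by
  have hcast : ∀ n : ℕ, (n : K) = 0 ↔ p ∣ n := CharP.cast_eq_zero_iff K p
  have hx : ∀ i, ∃ g ∈ B, IsSupersymmetric g ∧ IsLeadingTerm (exponent i 0 0) g := by
    intro i
    induction i using Nat.strong_induction_on with
    | _ i ih =>
      by_cases hi : i = 0
      · subst hi
        refine ⟨1, B.one_mem, ⟨0, isSupersymmetricOfDegree_one⟩, ?_⟩
        rw [isLeadingTerm_iff, one_def,
          show (0 : Fin 1 ⊕ Fin 2 → ℕ) = exponent 0 0 0 from exponent_ext rfl rfl rfl]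
        simp only [cf_monomial]
        refine ⟨by simp, fun i j k h => ?_⟩
        split_ifs at h
        · omega
        · exact absurd rfl h
      · obtain ⟨s, hs1, hs2⟩ := exists_not_dvd_choose_pow hp i hi
        have hpos := pow_pos hp.pos s
        have hgen : exponent (p ^ s) 0 0 ∈ generatingMonomials p := by
          rcases Nat.eq_zero_or_pos s with rfl | hs
          · exact Or.inr (Or.inl ⟨0, 0, le_rfl, Or.inl ⟨by omega, rfl⟩, by rw [pow_zero]⟩)
          · exact Or.inl ⟨s, hs, rfl⟩
        have h := exists_mem_leadingTerm_mul (hB _ hgen) (ih (i - p ^ s) (by omega)) (by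
          rw [structConst_exponent, Nat.add_sub_cancel' hs1]
          simpa using fun h => hs2 ((hcast _).mp h))
        rwa [exponent_add, Nat.add_sub_cancel' hs1] at h
  obtain ⟨d, hf⟩ := hf
  rw [eq_exponent a] at hl ⊢
  generalize a (Sum.inl 0) = i at hl ⊢
  generalize a (Sum.inr 0) = j at hl ⊢
  generalize a (Sum.inr 1) = k at hl ⊢
  have hkj := le_of_isLeadingTerm hf hl
  by_cases hj : j = 0
  · obtain rfl : k = 0 := by omega
    subst hj
    exact hx i
  have hi := not_dvd_of_isLeadingTerm (p := p) hf hl hj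
  obtain ⟨i, rfl⟩ := Nat.exists_eq_succ_of_ne_zero (n := i) (by rintro rfl; exact hi (dvd_zero p))
  by_cases hH : HeightOne p j k
  · have h := exists_mem_leadingTerm_mul (hx i)
      (hB _ (Or.inr (Or.inl ⟨j, k, hkj, hH, rfl⟩))) (by
        rw [structConst_exponent, Nat.choose_succ_self_right, zero_add, zero_add,
          Nat.choose_zero_right, Nat.choose_zero_right, mul_one, mul_one]
        exact fun h => hi ((hcast _).mp h))
    rwa [exponent_add, zero_add, zero_add] at h
  · have hi' : ¬ p ∣ i := fun h => hH (heightOne_of_isLeadingTerm hp hf hl h)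
    obtain ⟨i, rfl⟩ :=
      Nat.exists_eq_succ_of_ne_zero (n := i) (by rintro rfl; exact hi' (dvd_zero p))
    have h := exists_mem_leadingTerm_mul (hx i)
      (hB _ (Or.inr (Or.inr ⟨j, k, hkj, hH, rfl⟩))) (by
        rw [structConst_exponent, Nat.choose_symm_add, zero_add, zero_add,
          Nat.choose_zero_right, Nat.choose_zero_right, mul_one, mul_one, Ne, hcast]
        intro h
        have h2 : p ∣ (i + 2) * (i + 1) := by
          have e := Nat.add_one_mul_choose_eq (i + 1) 1
          rw [Nat.choose_one_right] at e
          rw [show (i + 2) * (i + 1) = (i + 2).choose 2 * 2 from e]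
          exact h.mul_right 2
        exact (hp.dvd_mul.mp h2).elim hi hi')
    rwa [exponent_add, zero_add, zero_add] at h

end Generation

end SuperDiv

end

theorem mainTheorem2 (p : ℕ) (hp : p.Prime) (hp2 : 2 < p)
    (K : Type*) [Field K] [CharP K p] :
    (∀ M ∈ SuperDiv.generatingMonomials p,
      ∃ f : SuperDiv K 1 2, SuperDiv.IsSupersymmetric f ∧ SuperDiv.IsLeadingTerm M f) ∧
    ∀ S : (Fin 1 ⊕ Fin 2 → ℕ) → SuperDiv K 1 2,
      (∀ M ∈ SuperDiv.generatingMonomials p,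
        SuperDiv.IsSupersymmetric (S M) ∧ SuperDiv.IsLeadingTerm M (S M)) →
      Algebra.adjoin K (S '' SuperDiv.generatingMonomials p) = SuperDiv.supersymmetricSubalgebra K 1 2 := by
  refine ⟨?_, fun S hS => le_antisymm (Algebra.adjoin_le ?_) fun f hf => ?_⟩
  · rintro M (⟨s, -, rfl⟩ | ⟨j₁, j₂, hj, hH, rfl⟩ | ⟨j₁, j₂, hj, -, rfl⟩)
    · exact SuperDiv.exists_leadingTerm_x (p ^ s)
    · exact SuperDiv.exists_leadingTerm_heightOne hp hj hH
    · refine SuperDiv.exists_leadingTerm_two (fun h => ?_) hj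
      have h' : ((2 : ℕ) : K) = 0 := by exact_mod_cast h
      have := Nat.le_of_dvd two_pos ((CharP.cast_eq_zero_iff K p 2).mp h')
      omega
  · rintro _ ⟨M, hM, rfl⟩
    exact Submodule.subset_span (hS M hM).1
  · have hle : Submodule.span K {f : SuperDiv K 1 2 | SuperDiv.IsSupersymmetric f}
        ≤ Subalgebra.toSubmodule (Algebra.adjoin K (S '' SuperDiv.generatingMonomials p)) :=
      Submodule.span_le.mpr fun g hg => SuperDiv.mem_of_forall_leadingTerm
        (SuperDiv.exists_mem_leadingTerm hp hp2 fun M hM =>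
          ⟨S M, Algebra.subset_adjoin (Set.mem_image_of_mem S hM), hS M hM⟩) hg
    exact hle hf
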